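/- Let $\omega$ be a nonreal cube root of unity, and consider the following seven pure states of three qubits, in $\mathbb{C}^2\otimes\mathbb{C}^2\otimes\mathbb{C}^2$: \[ \begin{aligned} \psi_1&=\tfrac12(|000\rangle+|011\rangle+|101\rangle+|110\rangle), & \psi_2&=\tfrac12(|000\rangle+|011\rangle-|101\rangle-|110\rangle),\\ \psi_3&=\tfrac12(|000\rangle-|011\rangle+|101\rangle-|110\rangle), & \psi_4&=\tfrac12(|000\rangle-|011\rangle-|101\rangle+|110\rangle),\\ \psi_5&=\tfrac1{\sqrt3}(|001\rangle+|010\rangle+|100\rangle), & \psi_6&=\tfrac1{\sqrt3}(|001\rangle+\omega|010\rangle+\omega^2|100\rangle),\\ \psi_7&=\tfrac1{\sqrt3}(|001\rangle+\omega^2|010\rangle+\omega|100\rangle). \end{aligned} \] Across every bipartition of the three qubits into two nonempty groups, these states form an unextendible entangled basis (that is, they are orthonormal, each of them is entangled across the bipartition, they span a proper subspace, and every vector orthogonal to all of them is a product vector across the bipartition), and they are locally indistinguishable: no protocol of local quantum operations and classical communication between the two groups (in each round one group performs a local measurement, with finitely many outcomes, and announces the outcome; the number of rounds may be unbounded) identifies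 with certainty which of the seven states the system is in. Moreover, the subset of the first five states $\{\psi_1,\dots,\psi_5\}$ (the four GHZ-type states and the first W-type state) is also locally indistinguishable, in the same sense, across every bipartition. -/

import Mathlib

open scoped Kronecker Matrix InnerProductSpace

/-! ### Bipartite LOCC protocols -/

/-- What is done at one stage of a bipartite LOCC protocol, when the two parties (Alice, Bob)
currently hold systems `ℂ^m` and `ℂ^n`. `S m' n'` is the type of the possible stages of the
protocol at which the systems held are `ℂ^m'` and `ℂ^n'`. Either the protocol stops
and outputs a value, or one party performs a local generalized measurement, given by finitely many
Kraus operators `K a` with `∑ a, (K a)ᴴ * K a = 1`, and announces the outcome `a`, upon which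
the protocol continues at a stage that may depend on `a`.
The dimension `d a` of the system after the measurement is arbitrary, so that local ancillas may
be appended and local subsystems may be discarded. -/
inductive LOCCStep (α : Type) (S : ℕ → ℕ → Type) (m n : ℕ) : Type
  | halt (x : α) : LOCCStep α S m n
  | alice (k : ℕ) (d : Fin k → ℕ) (K : (a : Fin k) → Matrix (Fin (d a)) (Fin m) ℂ)
      (hK : ∑ a, (K a)ᴴ * K a = 1) (next : (a : Fin k) → S (d a) n) : LOCCStep α S m n
  | bob (k : ℕ) (d : Fin k → ℕ) (K : (a : Fin k) → Matrix (Fin (d a)) (Fin n) ℂ)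
      (hK : ∑ a, (K a)ᴴ * K a = 1) (next : (a : Fin k) → S m (d a)) : LOCCStep α S m n

/-- An LOCC protocol on `ℂ^m ⊗ ℂ^n` with output in `α`. The number of rounds may depend on the
outcomes obtained on the way, and it need not be bounded. -/
structure LOCCProtocol (α : Type) (m n : ℕ) where
  /-- the stages of the protocol (they can record the whole history of outcomes) -/
  Stage : ℕ → ℕ → Type
  /-- what is done at each stage -/
  step : {m' n' : ℕ} → Stage m' n' → LOCCStep α Stage m' n'
  /-- the initial stage -/
  start : Stage m n

/-- The probability that a protocol, continued from the stage `s` with the joint state `φ`, stops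
after at most `N` measurements with output `x`. Here `φ` is not renormalized
after a measurement: its squared norm is the probability of the outcomes so far. -/
noncomputable def loccProb {α : Type} [DecidableEq α] {S : ℕ → ℕ → Type}
    (step : {m' n' : ℕ} → S m' n' → LOCCStep α S m' n') (x : α) :
    (N : ℕ) → {m n : ℕ} → (s : S m n) → (φ : Fin m × Fin n → ℂ) → ℝ
  | 0, _, _, s, φ =>
    match step s with
    | .halt y => if y = x then ∑ p, ‖φ p‖ ^ 2 else 0
    | .alice _ _ _ _ _ => 0
    | .bob _ _ _ _ _ => 0
  | N + 1, m, n, s, φ =>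
    match step s with
    | .halt y => if y = x then ∑ p, ‖φ p‖ ^ 2 else 0
    | .alice _ _ K _ next =>
        ∑ a, loccProb step x N (next a) ((K a ⊗ₖ (1 : Matrix (Fin n) (Fin n) ℂ)) *ᵥ φ)
    | .bob _ _ K _ next =>
        ∑ a, loccProb step x N (next a) (((1 : Matrix (Fin m) (Fin m) ℂ) ⊗ₖ K a) *ᵥ φ)

/-- The protocol identifies each of the states `φ i` with certainty: started in `φ i`, it stops
with output `i` with probability one. -/
def LOCCProtocol.Identifies {k m n : ℕ} (P : LOCCProtocol (Fin k) m n)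
    (φ : Fin k → Fin m × Fin n → ℂ) : Prop :=
  ∀ i, Filter.Tendsto (fun N => loccProb P.step i N P.start (φ i)) Filter.atTop (nhds 1)

/-- Perfect distinguishability by LOCC of finitely many states of the bipartite system
`ℂ^ι ⊗ ℂ^κ`. (The enumerations `e`, `f` of the local computational bases are immaterial.) -/
def LOCCDistinguishable {ι κ : Type} {k : ℕ} (φ : Fin k → ι × κ → ℂ) : Prop :=
  ∃ (m n : ℕ) (e : ι ≃ Fin m) (f : κ ≃ Fin n) (P : LOCCProtocol (Fin k) m n),
    P.Identifies (fun i p => φ i (e.symm p.1, f.symm p.2))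

/-! ### Three qubits and their bipartitions -/

/-- The Hilbert space `ℂ² ⊗ ℂ² ⊗ ℂ²`, with its computational basis indexed by bit strings. -/
abbrev ThreeQubit : Type := EuclideanSpace ℂ (Fin 3 → Fin 2)

/-- `S` and its complement are the two sides of a bipartition of the three qubits. -/
def IsBipartition (S : Finset (Fin 3)) : Prop := S.Nonempty ∧ Sᶜ.Nonempty

/-- A three-qubit vector, seen as a vector of the bipartite system formed by the qubits in `S`
and the qubits outside `S`. -/
def acrossCut (S : Finset (Fin 3)) (ψ : ThreeQubit) :
    ({i // i ∈ S} → Fin 2) × ({i // i ∉ S} → Fin 2) → ℂ :=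
  fun p => ψ ((Equiv.piEquivPiSubtypeProd (fun i => i ∈ S) (fun _ => Fin 2)).symm p)

/-- The vector is a product across the bipartition `S | Sᶜ`. -/
def IsProductAcross (S : Finset (Fin 3)) (ψ : ThreeQubit) : Prop :=
  ∃ (u : ({i // i ∈ S} → Fin 2) → ℂ) (v : ({i // i ∉ S} → Fin 2) → ℂ),
    ∀ a b, acrossCut S ψ (a, b) = u a * v b

/-- Unextendible entangled basis with respect to the bipartition `S | Sᶜ`: orthonormal entangled
states that span a proper subspace, whose orthogonal complement has no entangled vector. -/
def IsUEBAcross {k : ℕ} (S : Finset (Fin 3)) (ψ : Fin k → ThreeQubit) : Prop :=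
  Orthonormal ℂ ψ ∧ (∀ i, ¬ IsProductAcross S (ψ i)) ∧
    Submodule.span ℂ (Set.range ψ) ≠ ⊤ ∧
    ∀ χ ∈ (Submodule.span ℂ (Set.range ψ))ᗮ, IsProductAcross S χ

/-- The states cannot be perfectly distinguished by LOCC between the qubits in `S` and the qubits
outside `S`. -/
def LocallyIndistinguishableAcross {k : ℕ} (S : Finset (Fin 3)) (ψ : Fin k → ThreeQubit) : Prop :=
  ¬ LOCCDistinguishable (fun i => acrossCut S (ψ i))

/-- The computational basis vector `|a b c⟩`. -/
noncomputable def ket (a b c : Fin 2) : ThreeQubit := EuclideanSpace.single ![a, b, c] 1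

/-- Four GHZ-type states followed by three W-type states. -/
noncomputable def ghzW (ω : ℂ) : Fin 7 → ThreeQubit :=
  ![(1 / 2 : ℂ) • (ket 0 0 0 + ket 0 1 1 + ket 1 0 1 + ket 1 1 0),
    (1 / 2 : ℂ) • (ket 0 0 0 + ket 0 1 1 - ket 1 0 1 - ket 1 1 0),
    (1 / 2 : ℂ) • (ket 0 0 0 - ket 0 1 1 + ket 1 0 1 - ket 1 1 0),
    (1 / 2 : ℂ) • (ket 0 0 0 - ket 0 1 1 - ket 1 0 1 + ket 1 1 0),
    (1 / (Real.sqrt 3 : ℂ)) • (ket 0 0 1 + ket 0 1 0 + ket 1 0 0),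
    (1 / (Real.sqrt 3 : ℂ)) • (ket 0 0 1 + ω • ket 0 1 0 + ω ^ 2 • ket 1 0 0),
    (1 / (Real.sqrt 3 : ℂ)) • (ket 0 0 1 + ω ^ 2 • ket 0 1 0 + ω • ket 1 0 0)]

/-- The first five of these states: the four GHZ-type states and the first W-type state. -/
noncomputable def ghzWFive (ω : ℂ) : Fin 5 → ThreeQubit :=
  fun i => ghzW ω (Fin.castLE (by norm_num) i)

/-! ### A dimension bound for LOCC identification -/

/-! Suppose state `i` has squared overlap at most `1 / c i` with every normalized product vector.
Along an LOCC branch the accumulated operator is `A ⊗ₖ B`, whose rows are product vectors, so a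
branch announcing `i` contributes at most `frobSq A * frobSq B` to `c i` times the success
probability. Completeness of the Kraus operators makes these weights add up to at most the total
dimension, whatever the number of rounds (`sum_mul_loccProb_le`). Perfect identification thus forces
`∑ c i ≤ 8` (`LOCCDistinguishable.sum_le`). GHZ-type states allow `c = 2` and W-type states `c =
3/2`, so the sums are 25/2 for seven states and 19/2 for five, both too large. Since `c > 1`, the
same bounds give entanglement. The orthogonal complement contains only multiples of |111⟩, which are
products. -/

/-- The squared Frobenius norm of a matrix. -/
noncomputable def frobSq {l m : Type*} [Fintype l] [Fintype m] (A : Matrix l m ℂ) : ℝ :=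
  ∑ p, ∑ k, ‖A p k‖ ^ 2

lemma frobSq_nonneg {l m : Type*} [Fintype l] [Fintype m] (A : Matrix l m ℂ) : 0 ≤ frobSq A := by
  unfold frobSq; positivity

lemma frobSq_eq_re_trace {l m : Type*} [Fintype l] [Fintype m] (A : Matrix l m ℂ) :
    frobSq A = (Matrix.trace (Aᴴ * A)).re := by
  simp only [frobSq, Matrix.trace, Matrix.diag, Matrix.mul_apply, Matrix.conjTranspose_apply,
    Complex.re_sum]
  rw [Finset.sum_comm]
  refine Finset.sum_congr rfl fun i _ => Finset.sum_congr rfl fun j _ => ?_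
  rw [Complex.star_def, ← Complex.normSq_eq_conj_mul_self, Complex.normSq_eq_norm_sq,
    Complex.ofReal_re]

lemma frobSq_one (n : ℕ) : frobSq (1 : Matrix (Fin n) (Fin n) ℂ) = n := by
  rw [frobSq_eq_re_trace]; simp

lemma sum_frobSq_mul {k m l : ℕ} {d : Fin k → ℕ} (K : (a : Fin k) → Matrix (Fin (d a)) (Fin m) ℂ)
    (hK : ∑ a, (K a)ᴴ * K a = 1) (A : Matrix (Fin m) (Fin l) ℂ) :
    ∑ a, frobSq (K a * A) = frobSq A := by
  simp only [frobSq_eq_re_trace]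
  rw [← Complex.re_sum, ← Matrix.trace_sum]
  congr 2
  calc ∑ a, (K a * A)ᴴ * (K a * A) = ∑ a, Aᴴ * ((K a)ᴴ * K a) * A :=
        Finset.sum_congr rfl fun a _ => by
          simp only [Matrix.conjTranspose_mul, Matrix.mul_assoc]
    _ = Aᴴ * A := by rw [← Matrix.sum_mul, ← Matrix.mul_sum, hK, Matrix.mul_one]

/-- The squared overlap of `φ` with every normalized product vector is at most `1 / c`. -/
def OverlapBound {ι κ : Type*} [Fintype ι] [Fintype κ] (c : ℝ) (φ : ι × κ → ℂ) : Prop :=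
  ∀ (u : ι → ℂ) (v : κ → ℂ),
    c * ‖∑ p : ι × κ, φ p * (u p.1 * v p.2)‖ ^ 2 ≤ (∑ a, ‖u a‖ ^ 2) * ∑ b, ‖v b‖ ^ 2

/-- Row `(p, q)` of `A ⊗ₖ B` is the product of row `p` of `A` and row `q` of `B`; apply the overlap
bound to each row and sum. -/
lemma OverlapBound.kronecker {ι κ l r : Type*} [Fintype ι] [Fintype κ] [Fintype l] [Fintype r]
    {c : ℝ} {φ : ι × κ → ℂ} (h : OverlapBound c φ) (A : Matrix l ι ℂ) (B : Matrix r κ ℂ) :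
    c * ∑ p, ‖((A ⊗ₖ B) *ᵥ φ) p‖ ^ 2 ≤ frobSq A * frobSq B := by
  rw [frobSq, frobSq, Finset.sum_mul_sum, Fintype.sum_prod_type, Finset.mul_sum]
  refine Finset.sum_le_sum fun p _ => ?_
  rw [Finset.mul_sum]
  refine Finset.sum_le_sum fun q _ => ?_
  refine le_of_eq_of_le ?_ (h (A p) (B q))
  simp only [Matrix.mulVec, dotProduct, Matrix.kroneckerMap_apply]
  simp only [mul_comm]

/-- A local measurement protocol cannot identify weakly overlapping states too often: the
probabilities of correct identification, weighted by the inverse overlaps, are bounded by the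
squared Frobenius norms of the local operators applied beforehand. -/
lemma sum_mul_loccProb_le {k m₀ n₀ : ℕ} {S : ℕ → ℕ → Type}
    (step : {m n : ℕ} → S m n → LOCCStep (Fin k) S m n)
    {c : Fin k → ℝ} {φ : Fin k → Fin m₀ × Fin n₀ → ℂ} (hφ : ∀ i, OverlapBound (c i) (φ i))
    (N : ℕ) {m n : ℕ} (s : S m n)
    (A : Matrix (Fin m) (Fin m₀) ℂ) (B : Matrix (Fin n) (Fin n₀) ℂ) :
    ∑ i, c i * loccProb step i N s ((A ⊗ₖ B) *ᵥ φ i) ≤ frobSq A * frobSq B := by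
  have hpos : 0 ≤ frobSq A * frobSq B := mul_nonneg (frobSq_nonneg A) (frobSq_nonneg B)
  induction N generalizing m n with
  | zero =>
    simp only [loccProb]
    cases step s with
    | halt y => simpa using (hφ y).kronecker A B
    | alice => simpa using hpos
    | bob => simpa using hpos
  | succ N ih =>
    simp only [loccProb]
    cases step s with
    | halt y => simpa using (hφ y).kronecker A B
    | alice k d K hK next =>
      simp only [Finset.mul_sum]
      rw [Finset.sum_comm, ← sum_frobSq_mul K hK A, Finset.sum_mul]
      refine Finset.sum_le_sum fun a _ => ?_
      -- The Kraus operator is absorbed into Alice's accumulated operator, `A` becoming `K a * A`;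
      -- hence the induction over arbitrary `A` and `B`.
      simp only [Matrix.mulVec_mulVec, ← Matrix.mul_kronecker_mul, Matrix.one_mul]
      exact ih _ _ _ (mul_nonneg (frobSq_nonneg _) (frobSq_nonneg _))
    | bob k d K hK next =>
      simp only [Finset.mul_sum]
      rw [Finset.sum_comm, ← sum_frobSq_mul K hK B, Finset.mul_sum]
      refine Finset.sum_le_sum fun a _ => ?_
      simp only [Matrix.mulVec_mulVec, ← Matrix.mul_kronecker_mul, Matrix.one_mul]
      exact ih _ _ _ (mul_nonneg (frobSq_nonneg _) (frobSq_nonneg _))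

lemma OverlapBound.comp_equiv {ι κ ι' κ' : Type*} [Fintype ι] [Fintype κ] [Fintype ι'] [Fintype κ']
    {c : ℝ} {φ : ι × κ → ℂ} (h : OverlapBound c φ) (e : ι ≃ ι') (f : κ ≃ κ') :
    OverlapBound c (fun p : ι' × κ' => φ (e.symm p.1, f.symm p.2)) := by
  intro u v
  have := h (u ∘ e) (v ∘ f)
  rw [← (e.prodCongr f).sum_comp, ← e.sum_comp, ← f.sum_comp]
  simpa using this

/-- If states of `ℂ^ι ⊗ ℂ^κ` are distinguishable by LOCC, the sum of their inverse maximal product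
overlaps is at most the dimension. -/
theorem LOCCDistinguishable.sum_le {ι κ : Type} [Fintype ι] [Fintype κ] {k : ℕ} {c : Fin k → ℝ}
    {φ : Fin k → ι × κ → ℂ} (hφ : ∀ i, OverlapBound (c i) (φ i)) (h : LOCCDistinguishable φ) :
    ∑ i, c i ≤ (Fintype.card ι : ℝ) * Fintype.card κ := by
  obtain ⟨m, n, e, f, P, hP⟩ := h
  have hlim := tendsto_finsetSum (Finset.univ : Finset (Fin k)) fun i _ => (hP i).const_mul (c i)
  simp only [mul_one] at hlim
  -- The bound is uniform in `N`, so it survives the limit even for unbounded protocols.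
  refine le_of_tendsto' hlim fun N => ?_
  have := sum_mul_loccProb_le P.step (fun i => (hφ i).comp_equiv e f) N P.start 1 1
  rw [frobSq_one, frobSq_one] at this
  simpa [Fintype.card_congr e, Fintype.card_congr f] using this

/-! ### Product vectors of three qubits -/

lemma sum_bits {M : Type*} [AddCommMonoid M] (F : (Fin 3 → Fin 2) → M) :
    ∑ x, F x = ∑ a, ∑ b, ∑ c, F ![a, b, c] := by
  let e : Fin 2 × Fin 2 × Fin 2 ≃ (Fin 3 → Fin 2) :=
    { toFun := fun p => ![p.1, p.2.1, p.2.2]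
      invFun := fun x => (x 0, x 1, x 2)
      left_inv := fun _ => rfl
      right_inv := fun x => by ext i; fin_cases i <;> rfl }
  rw [← e.sum_comp]
  simp only [Fintype.sum_prod_type]
  rfl

/-- The vector is a product of a vector of qubit `i` and a vector of the two other qubits. -/
def FactorsAt (i : Fin 3) (f : (Fin 3 → Fin 2) → ℂ) : Prop :=
  ∃ (g : Fin 2 → ℂ) (h : Fin 2 → Fin 2 → ℂ), ∀ x, f x = g (x i) * h (x (i + 1)) (x (i + 2))

/-- One side of a bipartition of three qubits is always a single qubit. -/
lemma IsBipartition.exists_factorsAt {S : Finset (Fin 3)} (hS : IsBipartition S)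
    (u : ({i // i ∈ S} → Fin 2) → ℂ) (v : ({i // i ∉ S} → Fin 2) → ℂ) :
    ∃ i, FactorsAt i fun x => u (fun j => x j) * v (fun j => x j) := by
  have key : ∀ S : Finset (Fin 3), S.Nonempty ∧ Sᶜ.Nonempty →
      ∃ i, (∀ j, j ∈ S ↔ j = i) ∨ (∀ j, j ∉ S ↔ j = i) := by decide
  have other : ∀ i j : Fin 3, j ≠ i → j = i + 1 ∨ j = i + 2 := by decide
  have ne : ∀ i : Fin 3, i + 2 ≠ i + 1 := by decide
  have glue : ∀ (x : Fin 3 → Fin 2) (i j : Fin 3), j ≠ i →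
      x j = if j = i + 1 then x (i + 1) else x (i + 2) := by
    intro x i j hj
    rcases other i j hj with rfl | rfl
    · simp
    · simp [ne]
  obtain ⟨i, hi | hi⟩ := key S hS
  · refine ⟨i, fun t => u fun _ => t, fun s t => v fun j => if (j : Fin 3) = i + 1 then s else t,
      fun x => ?_⟩
    exact congrArg₂ (· * ·) (congrArg u (funext fun j => by rw [(hi j).1 j.2]))
      (congrArg v (funext fun j => glue x i j fun h => j.2 ((hi j).2 h)))
  · refine ⟨i, fun t => v fun _ => t, fun s t => u fun j => if (j : Fin 3) = i + 1 then s else t,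
      fun x => ?_⟩
    exact (mul_comm _ _).trans (congrArg₂ (· * ·)
      (congrArg v (funext fun j => by rw [(hi j).1 j.2]))
      (congrArg u (funext fun j => glue x i j fun h => (hi j).2 h j.2)))

/-- The squared overlap of `ψ` with every normalized vector that is a product of a qubit and the
two other qubits is at most `1 / c`. -/
def QubitOverlapBound (c : ℝ) (ψ : ThreeQubit) : Prop :=
  ∀ (i : Fin 3) (f : (Fin 3 → Fin 2) → ℂ), FactorsAt i f →
    c * ‖∑ x, ψ x * f x‖ ^ 2 ≤ ∑ x, ‖f x‖ ^ 2

lemma QubitOverlapBound.acrossCut {S : Finset (Fin 3)} (hS : IsBipartition S) {c : ℝ}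
    {ψ : ThreeQubit} (h : QubitOverlapBound c ψ) : OverlapBound c (acrossCut S ψ) := by
  intro u v
  obtain ⟨i, hi⟩ := hS.exists_factorsAt u v
  have := h i _ hi
  let e := Equiv.piEquivPiSubtypeProd (fun i => i ∈ S) (fun _ => Fin 2)
  rw [← e.sum_comp, Finset.sum_mul_sum, ← Fintype.sum_prod_type', ← e.sum_comp]
  simpa [_root_.acrossCut, e, Equiv.piEquivPiSubtypeProd, mul_pow] using this

lemma QubitOverlapBound.not_isProductAcross {S : Finset (Fin 3)} (hS : IsBipartition S) {c : ℝ}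
    (hc : 1 < c) {ψ : ThreeQubit} (hψ : ‖ψ‖ = 1) (h : QubitOverlapBound c ψ) :
    ¬ IsProductAcross S ψ := by
  rintro ⟨u, v, huv⟩
  have hprod : ∀ x, ψ x = u (fun j => x j) * v (fun j => x j) := fun x => by
    rw [← huv]
    exact congrArg ψ ((Equiv.piEquivPiSubtypeProd (fun i => i ∈ S) _).symm_apply_apply x).symm
  obtain ⟨i, g, k, hgk⟩ := hS.exists_factorsAt u v
  -- The overlap is bilinear, so testing against the conjugate of `ψ` yields the squared norm 1,
  -- giving `c ≤ 1`.
  have := h i (fun x => star (ψ x)) ⟨fun a => star (g a), fun a b => star (k a b), fun x => by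
    simp only [hprod, hgk, star_mul']⟩
  have hnorm : ∑ x, ‖ψ x‖ ^ 2 = 1 := by rw [← EuclideanSpace.norm_sq_eq, hψ, one_pow]
  have hsum : ∑ x, ψ x * star (ψ x) = 1 := by
    have : ∀ x, ψ x * star (ψ x) = ((‖ψ x‖ ^ 2 : ℝ) : ℂ) := fun x => by
      rw [Complex.star_def, Complex.mul_conj, Complex.normSq_eq_norm_sq]
    simp only [this, ← Complex.ofReal_sum, hnorm, Complex.ofReal_one]
  rw [hsum] at this
  simp only [norm_star, hnorm, norm_one, one_pow, mul_one] at this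
  linarith

/-! ### Overlaps of the GHZ-type and W-type states -/

lemma norm_add_sq_le_two_mul (a b : ℂ) : ‖a + b‖ ^ 2 ≤ 2 * (‖a‖ ^ 2 + ‖b‖ ^ 2) := by
  nlinarith [norm_add_le a b, norm_nonneg (a + b), sq_nonneg (‖a‖ - ‖b‖), norm_nonneg a,
    norm_nonneg b]

lemma norm_mul_add_mul_sq_le (a b p q : ℂ) :
    ‖a * p + b * q‖ ^ 2 ≤ (‖a‖ ^ 2 + ‖b‖ ^ 2) * (‖p‖ ^ 2 + ‖q‖ ^ 2) := by
  have h := norm_add_le (a * p) (b * q)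
  rw [norm_mul, norm_mul] at h
  calc ‖a * p + b * q‖ ^ 2 ≤ (‖a‖ * ‖p‖ + ‖b‖ * ‖q‖) ^ 2 := by gcongr
    _ ≤ _ := by nlinarith [sq_nonneg (‖a‖ * ‖q‖ - ‖b‖ * ‖p‖)]

/-- Cauchy–Schwarz in `g`; the two brackets then involve disjoint pairs of entries of `h`, each pair
costing a factor 2. -/
lemma ghz_overlap_le {α β γ δ : ℂ} (hα : ‖α‖ = 1) (hβ : ‖β‖ = 1) (hγ : ‖γ‖ = 1) (hδ : ‖δ‖ = 1)
    (g : Fin 2 → ℂ) (h : Fin 2 → Fin 2 → ℂ) :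
    ‖g 0 * (α * h 0 0 + β * h 1 1) + g 1 * (γ * h 0 1 + δ * h 1 0)‖ ^ 2 ≤
      2 * ∑ a, ∑ b, ∑ c, ‖g a * h b c‖ ^ 2 := by
  have h₀ := norm_add_sq_le_two_mul (α * h 0 0) (β * h 1 1)
  have h₁ := norm_add_sq_le_two_mul (γ * h 0 1) (δ * h 1 0)
  simp only [norm_mul, hα, hβ, hγ, hδ, one_mul] at h₀ h₁
  refine (norm_mul_add_mul_sq_le _ _ _ _).trans ?_
  refine (mul_le_mul_of_nonneg_left (add_le_add h₀ h₁) (by positivity)).trans (le_of_eq ?_)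
  simp only [Fin.sum_univ_two, norm_mul]
  ring

lemma w_overlap_le {α β γ : ℂ} (hα : ‖α‖ = 1) (hβ : ‖β‖ = 1) (hγ : ‖γ‖ = 1)
    (g : Fin 2 → ℂ) (h : Fin 2 → Fin 2 → ℂ) :
    ‖g 0 * (α * h 0 1 + β * h 1 0) + g 1 * (γ * h 0 0)‖ ^ 2 ≤
      2 * ∑ a, ∑ b, ∑ c, ‖g a * h b c‖ ^ 2 := by
  have h₀ := norm_add_sq_le_two_mul (α * h 0 1) (β * h 1 0)
  -- Deliberately wasteful: the factor 2 matches `h₀`, and `h 1 1` completes the sum over all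
  -- entries.
  have h₁ : ‖γ * h 0 0‖ ^ 2 ≤ 2 * (‖h 0 0‖ ^ 2 + ‖h 1 1‖ ^ 2) := by
    rw [norm_mul, hγ, one_mul]
    nlinarith [sq_nonneg ‖h 0 0‖, sq_nonneg ‖h 1 1‖]
  simp only [norm_mul, hα, hβ, one_mul] at h₀
  refine (norm_mul_add_mul_sq_le _ _ _ _).trans ?_
  refine (mul_le_mul_of_nonneg_left (add_le_add h₀ h₁) (by positivity)).trans (le_of_eq ?_)
  simp only [Fin.sum_univ_two, norm_mul]
  ring

lemma ket_apply (a b c a' b' c' : Fin 2) :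
    ket a b c ![a', b', c'] = if a' = a ∧ b' = b ∧ c' = c then 1 else 0 := by
  simp [ket, funext_iff, Fin.forall_fin_succ]

/-- The GHZ-type vector with the given phases. -/
noncomputable def ghzState (α β γ δ : ℂ) : ThreeQubit :=
  (1 / 2 : ℂ) • (α • ket 0 0 0 + β • ket 0 1 1 + γ • ket 1 0 1 + δ • ket 1 1 0)

/-- The W-type vector with the given phases. -/
noncomputable def wState (α β γ : ℂ) : ThreeQubit :=
  (1 / (Real.sqrt 3 : ℂ)) • (α • ket 0 0 1 + β • ket 0 1 0 + γ • ket 1 0 0)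

lemma ghzW_eq (ω : ℂ) : ghzW ω =
    ![ghzState 1 1 1 1, ghzState 1 1 (-1) (-1), ghzState 1 (-1) 1 (-1), ghzState 1 (-1) (-1) 1,
      wState 1 1 1, wState 1 ω (ω ^ 2), wState 1 (ω ^ 2) ω] := by
  simp only [ghzW, ghzState, wState, one_smul, neg_smul, ← sub_eq_add_neg]

lemma sum_ghzState_mul (α β γ δ : ℂ) (f : (Fin 3 → Fin 2) → ℂ) :
    ∑ x, ghzState α β γ δ x * f x =
      1 / 2 * (α * f ![0, 0, 0] + β * f ![0, 1, 1] + γ * f ![1, 0, 1] + δ * f ![1, 1, 0]) := by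
  simp [sum_bits, ghzState, ket_apply]
  ring

lemma sum_wState_mul (α β γ : ℂ) (f : (Fin 3 → Fin 2) → ℂ) :
    ∑ x, wState α β γ x * f x =
      1 / (Real.sqrt 3 : ℂ) * (α * f ![0, 0, 1] + β * f ![0, 1, 0] + γ * f ![1, 0, 0]) := by
  simp [sum_bits, wState, ket_apply]
  ring

lemma qubitOverlapBound_ghzState {α β γ δ : ℂ} (hα : ‖α‖ = 1) (hβ : ‖β‖ = 1) (hγ : ‖γ‖ = 1)
    (hδ : ‖δ‖ = 1) : QubitOverlapBound 2 (ghzState α β γ δ) := by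
  rintro i f ⟨g, h, hf⟩
  rw [sum_ghzState_mul, norm_mul, mul_pow, sum_bits]
  norm_num only [norm_div, norm_one, RCLike.norm_ofNat]
  have key : ∀ {X Y : ℂ} {s t : ℝ}, X = Y → s = t → ‖Y‖ ^ 2 ≤ 2 * t →
      2 * (1 / 4 * ‖X‖ ^ 2) ≤ s := by
    rintro X Y s t rfl rfl h; linarith
  simp only [hf]
  fin_cases i
  · exact key (by simp; ring) rfl (ghz_overlap_le hα hβ hγ hδ g h)
  -- Singling out another qubit rotates the qubits cyclically, which permutes the last three phases.
  · exact key (by simp; ring) (by simp [Fin.sum_univ_two]; ring) (ghz_overlap_le hα hγ hδ hβ g h)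
  · exact key (by simp; ring) (by simp [Fin.sum_univ_two]; ring) (ghz_overlap_le hα hδ hβ hγ g h)

lemma qubitOverlapBound_wState {α β γ : ℂ} (hα : ‖α‖ = 1) (hβ : ‖β‖ = 1) (hγ : ‖γ‖ = 1) :
    QubitOverlapBound (3 / 2) (wState α β γ) := by
  rintro i f ⟨g, h, hf⟩
  have h3 : ‖1 / (Real.sqrt 3 : ℂ)‖ ^ 2 = 1 / 3 := by
    rw [norm_div, norm_one, Complex.norm_real, Real.norm_of_nonneg (Real.sqrt_nonneg 3), div_pow,
      Real.sq_sqrt (by norm_num), one_pow]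
  rw [sum_wState_mul, norm_mul, mul_pow, sum_bits, h3]
  have key : ∀ {X Y : ℂ} {s t : ℝ}, X = Y → s = t → ‖Y‖ ^ 2 ≤ 2 * t →
      3 / 2 * (1 / 3 * ‖X‖ ^ 2) ≤ s := by
    rintro X Y s t rfl rfl h; linarith
  simp only [hf]
  fin_cases i
  · exact key (by simp; ring) rfl (w_overlap_le hα hβ hγ g h)
  · exact key (by simp; ring) (by simp [Fin.sum_univ_two]; ring) (w_overlap_le hγ hα hβ g h)
  · exact key (by simp; ring) (by simp [Fin.sum_univ_two]; ring) (w_overlap_le hβ hγ hα g h)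

lemma qubitOverlapBound_ghzW {ω : ℂ} (hω : ‖ω‖ = 1) (i : Fin 7) :
    QubitOverlapBound (![2, 2, 2, 2, 3 / 2, 3 / 2, 3 / 2] i) (ghzW ω i) := by
  rw [ghzW_eq]
  fin_cases i
  iterate 4 exact qubitOverlapBound_ghzState (by simp) (by simp) (by simp) (by simp)
  · exact qubitOverlapBound_wState (by simp) (by simp) (by simp)
  iterate 2 exact qubitOverlapBound_wState (by simp) (by simp [hω]) (by simp [hω])

lemma card_mul_card (S : Finset (Fin 3)) :
    (Fintype.card ({i // i ∈ S} → Fin 2) : ℝ) * Fintype.card ({i // i ∉ S} → Fin 2) = 8 := by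
  rw [← Nat.cast_mul, ← Fintype.card_prod,
    ← Fintype.card_congr (Equiv.piEquivPiSubtypeProd (fun i => i ∈ S) (fun _ => Fin 2))]
  norm_num

/-! ### Orthogonality relations -/

lemma inner_eq_sum_mul_star (ψ χ : ThreeQubit) : ⟪ψ, χ⟫_ℂ = star (∑ x, ψ x * star (χ x)) := by
  simp [PiLp.inner_apply, mul_comm]

lemma inner_ghzState (α β γ δ : ℂ) (χ : ThreeQubit) : ⟪ghzState α β γ δ, χ⟫_ℂ =
    1 / 2 * (star α * χ ![0, 0, 0] + star β * χ ![0, 1, 1] + star γ * χ ![1, 0, 1] +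
      star δ * χ ![1, 1, 0]) := by
  rw [inner_eq_sum_mul_star, sum_ghzState_mul]
  simp

lemma inner_wState (α β γ : ℂ) (χ : ThreeQubit) : ⟪wState α β γ, χ⟫_ℂ =
    1 / (Real.sqrt 3 : ℂ) *
      (star α * χ ![0, 0, 1] + star β * χ ![0, 1, 0] + star γ * χ ![1, 0, 0]) := by
  rw [inner_eq_sum_mul_star, sum_wState_mul]
  simp

lemma star_eq_sq {ω : ℂ} (hω : ω ^ 3 = 1) : star ω = ω ^ 2 := by
  have hn : ‖ω‖ = 1 := Complex.norm_eq_one_of_pow_eq_one hω (by norm_num)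
  have h1 : ω * star ω = 1 := by
    rw [Complex.star_def, Complex.mul_conj, Complex.normSq_eq_norm_sq, hn]; simp
  linear_combination ω ^ 2 * h1 - star ω * hω

lemma one_add_add_sq {ω : ℂ} (hω : ω ^ 3 = 1) (hω' : ω.im ≠ 0) : 1 + ω + ω ^ 2 = 0 := by
  have h : ω - 1 ≠ 0 := fun h => hω' (by rw [sub_eq_zero.1 h]; simp)
  refine (mul_eq_zero.1 (?_ : (ω - 1) * (1 + ω + ω ^ 2) = 0)).resolve_left h
  linear_combination hω

lemma inner_ghzState_ghzState (α β γ δ α' β' γ' δ' : ℂ) :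
    ⟪ghzState α β γ δ, ghzState α' β' γ' δ'⟫_ℂ =
      1 / 4 * (star α * α' + star β * β' + star γ * γ' + star δ * δ') := by
  rw [inner_ghzState]
  simp [ghzState, ket_apply]
  ring

lemma inner_ghzState_wState (α β γ δ α' β' γ' : ℂ) :
    ⟪ghzState α β γ δ, wState α' β' γ'⟫_ℂ = 0 := by
  rw [inner_ghzState]
  simp [wState, ket_apply]

lemma inner_wState_ghzState (α β γ α' β' γ' δ' : ℂ) :
    ⟪wState α β γ, ghzState α' β' γ' δ'⟫_ℂ = 0 := by
  rw [inner_wState]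
  simp [ghzState, ket_apply]

lemma inner_wState_wState (α β γ α' β' γ' : ℂ) :
    ⟪wState α β γ, wState α' β' γ'⟫_ℂ = 1 / 3 * (star α * α' + star β * β' + star γ * γ') := by
  have h3 : (1 / (Real.sqrt 3 : ℂ)) * (1 / (Real.sqrt 3 : ℂ)) = 1 / 3 := by
    rw [div_mul_div_comm, ← Complex.ofReal_mul, Real.mul_self_sqrt (by norm_num)]; norm_num
  rw [inner_wState, ← h3]
  simp [wState, ket_apply]
  ring

lemma orthonormal_ghzW {ω : ℂ} (hω : ω ^ 3 = 1) (hω' : ω.im ≠ 0) : Orthonormal ℂ (ghzW ω) := by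
  have h1 := one_add_add_sq hω hω'
  have hs : (starRingEnd ℂ) ω = ω ^ 2 := star_eq_sq hω
  rw [orthonormal_iff_ite, ghzW_eq]
  intro i j
  fin_cases i <;> fin_cases j <;>
    simp [-inner_self_eq_norm_sq_to_K, inner_ghzState_ghzState, inner_ghzState_wState,
      inner_wState_ghzState, inner_wState_wState, hs] <;> grind

/-- The GHZ-type coefficients form a 4 × 4 Hadamard matrix on the even-weight strings, the W-type
ones a Fourier matrix of order 3 on the weight-one strings. Both are invertible, leaving only |111⟩.
-/
lemma apply_eq_zero_of_mem_orthogonal {ω : ℂ} (hω : ω ^ 3 = 1) (hω' : ω.im ≠ 0) {χ : ThreeQubit}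
    (hχ : χ ∈ (Submodule.span ℂ (Set.range (ghzW ω)))ᗮ) {x : Fin 3 → Fin 2}
    (hx : ∃ i, x i ≠ 1) : χ x = 0 := by
  have h1 := one_add_add_sq hω hω'
  have hs : (starRingEnd ℂ) ω = ω ^ 2 := star_eq_sq hω
  have horth : ∀ i, ⟪ghzW ω i, χ⟫_ℂ = 0 := fun i =>
    (Submodule.mem_orthogonal _ χ).1 hχ _ (Submodule.subset_span ⟨i, rfl⟩)
  rw [ghzW_eq] at horth
  simp [Fin.forall_fin_succ, inner_ghzState, inner_wState, hs] at horth
  obtain ⟨e1, e2, e3, e4, e5, e6, e7⟩ := horth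
  have hall : ∀ a b c : Fin 2, ![a, b, c] ≠ ![1, 1, 1] → χ ![a, b, c] = 0 := by
    simp only [Fin.forall_fin_two]
    simp
    refine ⟨⟨⟨?_, ?_⟩, ?_, ?_⟩, ⟨?_, ?_⟩, ?_⟩ <;> grind
  have hx' : x = ![x 0, x 1, x 2] := by ext i; fin_cases i <;> rfl
  rw [hx']
  refine hall _ _ _ fun h => ?_
  obtain ⟨i, hi⟩ := hx
  rw [hx', h] at hi
  fin_cases i <;> simp at hi

lemma isProductAcross_of_mem_orthogonal {ω : ℂ} (hω : ω ^ 3 = 1) (hω' : ω.im ≠ 0)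
    (S : Finset (Fin 3)) {χ : ThreeQubit}
    (hχ : χ ∈ (Submodule.span ℂ (Set.range (ghzW ω)))ᗮ) : IsProductAcross S χ := by
  refine ⟨fun a => if a = 1 then 1 else 0, fun b => if b = 1 then χ 1 else 0, fun a b => ?_⟩
  let e := Equiv.piEquivPiSubtypeProd (fun i => i ∈ S) (fun _ => Fin 2)
  obtain ⟨x, hx⟩ := e.surjective (a, b)
  obtain ⟨rfl, rfl⟩ := Prod.mk.inj hx
  have hcut : acrossCut S χ (fun j => x j, fun j => x j) = χ x :=
    congrArg χ (e.symm_apply_apply x)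
  refine hcut.trans ?_
  by_cases h : x = 1
  · subst h
    simp [Pi.one_def]
  · rw [apply_eq_zero_of_mem_orthogonal hω hω' hχ (by simpa [funext_iff] using h), eq_comm,
      mul_eq_zero]
    by_contra! hne
    simp only [ne_eq, ite_eq_right_iff, Classical.not_imp, funext_iff, Subtype.forall] at hne
    refine h (funext fun i => ?_)
    by_cases hi : i ∈ S
    · exact hne.1.1 i hi
    · exact hne.2.1 i hi

lemma isUEBAcross_ghzW {ω : ℂ} (hω : ω ^ 3 = 1) (hω' : ω.im ≠ 0) {S : Finset (Fin 3)}
    (hS : IsBipartition S) : IsUEBAcross S (ghzW ω) := by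
  have hn : ‖ω‖ = 1 := Complex.norm_eq_one_of_pow_eq_one hω (by norm_num)
  refine ⟨orthonormal_ghzW hω hω', fun i => ?_, fun htop => ?_,
    fun χ hχ => isProductAcross_of_mem_orthogonal hω hω' S hχ⟩
  · refine (qubitOverlapBound_ghzW hn i).not_isProductAcross hS ?_
      ((orthonormal_ghzW hω hω').norm_eq_one i)
    fin_cases i <;> norm_num
  -- Seven vectors cannot span a space of dimension 8.
  · have h := finrank_range_le_card (R := ℂ) (ghzW ω)
    rw [Set.finrank, htop, finrank_top] at h
    norm_num at h

lemma locallyIndistinguishableAcross_ghzW {ω : ℂ} (hω : ω ^ 3 = 1) {S : Finset (Fin 3)}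
    (hS : IsBipartition S) : LocallyIndistinguishableAcross S (ghzW ω) := by
  have hn : ‖ω‖ = 1 := Complex.norm_eq_one_of_pow_eq_one hω (by norm_num)
  intro h
  have := h.sum_le fun i => (qubitOverlapBound_ghzW hn i).acrossCut hS
  rw [card_mul_card] at this
  norm_num [Fin.sum_univ_succ] at this

lemma locallyIndistinguishableAcross_ghzWFive {ω : ℂ} (hω : ω ^ 3 = 1) {S : Finset (Fin 3)}
    (hS : IsBipartition S) : LocallyIndistinguishableAcross S (ghzWFive ω) := by
  have hn : ‖ω‖ = 1 := Complex.norm_eq_one_of_pow_eq_one hω (by norm_num)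
  intro h
  have := h.sum_le fun i =>
    (qubitOverlapBound_ghzW hn (Fin.castLE (by norm_num) i)).acrossCut hS
  rw [card_mul_card] at this
  norm_num [Fin.sum_univ_succ] at this

theorem proposition6 (ω : ℂ) (hω : ω ^ 3 = 1) (hω' : ω.im ≠ 0) :
    (∀ S : Finset (Fin 3), IsBipartition S →
      IsUEBAcross S (ghzW ω) ∧ LocallyIndistinguishableAcross S (ghzW ω)) ∧
    (∀ S : Finset (Fin 3), IsBipartition S →
      LocallyIndistinguishableAcross S (ghzWFive ω)) :=
  ⟨fun _ hS => ⟨isUEBAcross_ghzW hω hω' hS, locallyIndistinguishableAcross_ghzW hω hS⟩,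
    fun _ hS => locallyIndistinguishableAcross_ghzWFive hω hS⟩
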